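/- Let $X$ be a metric space and let $R$ be an associative ring with unit. If $X$ has straight finite decomposition complexity, then $X$ is coarsely coherent (with respect to $R$). Here the terms have the following meaning. For $S\subseteq X$ and $r\ge 0$ let $S[r]=\{y\in X : \inf_{s\in S}d(y,s)\le r\}$ (with $\emptyset[r]=\emptyset$), and write $x[r]$ for the closed ball of radius $r$ about $x$. *Straight finite decomposition complexity.* A collection of subsets of $X$ is $r$-disjoint if $d(a,b)>r$ whenever $a$ and $b$ lie in two distinct members of it. A family $\mathcal U$ of subsets of $X$ is $r$-decomposable over a family $\mathcal V$ if every $U\in\mathcal U$ can be written as $U=A\cup B$, where each of $A$ and $B$ is the union of an $r$-disjoint collection of members of $\mathcal V$. The space $X$ has straight finite decomposition complexity if for every sequence $0<R_1\le R_2\le\cdots$ of real numbers there are $n\ge 0$ and families $\mathcal V_0=\{X\},\mathcal V_1,\dots,\mathcal V_n$ of subsets of $X$ such that $\mathcal V_{i-1}$ is $R_i$-decomposable over $\mathcal V_i$ for $1\le i\le n$ and the diameters of the members of $\mathcal V_n$ are bounded by a common constant. *Coarse coherence.* An $X$-filtered $R$-module is a left $R$-module $F$ with submodules $F(S)\subseteq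 F$ for all $S\subseteq X$ such that $F(S)\subseteq F(T)$ for $S\subseteq T$, $F(X)=F$ and $F(\emptyset)=0$. It is - lean if there is $D\ge 0$ with $F(S)\subseteq\sum_{x\in S}F(x[D])$ for all $S\subseteq X$; - scattered if there is $\delta\ge 0$ with $F(X)\subseteq\sum_{x\in X}F(x[\delta])$; - insular if there is $d\ge 0$ with $F(S)\cap F(U)\subseteq F(S[d]\cap U[d])$ for all $S,U\subseteq X$. An $R$-homomorphism $f\colon F\to F'$ of $X$-filtered $R$-modules is bicontrolled if there is $b\ge 0$ with $f(F(S))\subseteq F'(S[b])$ and $f(F)\cap F'(S)\subseteq f(F(S[b]))$ for all $S\subseteq X$. The space $X$ is coarsely coherent (with respect to $R$) if for every short exact sequence $0\to E'\xrightarrow{f}E\xrightarrow{g}E''\to 0$ of $R$-modules, where $E',E,E''$ are $X$-filtered and $f,g$ are bicontrolled, if $E$ is lean and $E''$ is insular, then $E'$ is scattered. -/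

import Mathlib

universe u v w

/-- An `X`-filtered `R`-module with underlying module `M = F(X)`: a submodule `F(S)` of `M` for each
subset `S` of `X`, monotone in `S`, with `F(X) = M` and `F(∅) = 0`. -/
structure FilteredModule (R : Type*) (X : Type*) (M : Type*) [Ring R] [AddCommGroup M]
    [Module R M] where
  /-- The submodule `F(S)` attached to the subset `S`. -/
  obj : Set X → Submodule R M
  mono : ∀ ⦃S T : Set X⦄, S ⊆ T → obj S ≤ obj T
  obj_univ : obj Set.univ = ⊤
  obj_empty : obj ∅ = ⊥

namespace FilteredModule

/-- `F(S) ⊆ ∑_{x ∈ S} F(x[D])` for every `S`, for some `D ≥ 0`. -/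
def IsLeanModule {R X M : Type*} [MetricSpace X] [Ring R] [AddCommGroup M] [Module R M]
    (F : FilteredModule R X M) : Prop :=
  ∃ D : ℝ, 0 ≤ D ∧ ∀ S : Set X, F.obj S ≤ ⨆ x ∈ S, F.obj (Metric.closedBall x D)

/-- `F(X) ⊆ ∑_{x ∈ X} F(x[δ])` for some `δ ≥ 0`. -/
def IsScattered {R X M : Type*} [MetricSpace X] [Ring R] [AddCommGroup M] [Module R M]
    (F : FilteredModule R X M) : Prop :=
  ∃ δ : ℝ, 0 ≤ δ ∧ F.obj Set.univ ≤ ⨆ x : X, F.obj (Metric.closedBall x δ)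

/-- `F(S) ∩ F(U) ⊆ F(S[d] ∩ U[d])` for all `S`, `U`, for some `d ≥ 0`.
The enlargement `S[d]` is the set of points at distance at most `d` from `S`. -/
def IsInsular {R X M : Type*} [MetricSpace X] [Ring R] [AddCommGroup M] [Module R M]
    (F : FilteredModule R X M) : Prop :=
  ∃ d : ℝ, 0 ≤ d ∧ ∀ S U : Set X,
    F.obj S ⊓ F.obj U ≤ F.obj (Metric.cthickening d S ∩ Metric.cthickening d U)

/-- A homomorphism `f` is bicontrolled if for some `b ≥ 0` and all subsets `S`, both
`f(F(S)) ⊆ F'(S[b])` and `f(F) ∩ F'(S) ⊆ f(F(S[b]))`. -/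
def IsBicontrolled {R X M M' : Type*} [MetricSpace X] [Ring R] [AddCommGroup M] [Module R M]
    [AddCommGroup M'] [Module R M'] (F : FilteredModule R X M) (F' : FilteredModule R X M')
    (f : M →ₗ[R] M') : Prop :=
  ∃ b : ℝ, 0 ≤ b ∧ ∀ S : Set X,
    (F.obj S).map f ≤ F'.obj (Metric.cthickening b S) ∧
    LinearMap.range f ⊓ F'.obj S ≤ (F.obj (Metric.cthickening b S)).map f

end FilteredModule

/-- The metric space `X` is coarsely coherent (with respect to the coefficient ring `R`): in each
short exact sequence `0 → E' → E → E'' → 0` of `X`-filtered `R`-modules with bicontrolled maps, if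
`E` is lean and `E''` is insular then `E'` is scattered. -/
def CoarselyCoherent (R : Type u) [Ring R] (X : Type v) [MetricSpace X] : Prop :=
  ∀ (M' M M'' : Type w) [AddCommGroup M'] [AddCommGroup M] [AddCommGroup M'']
    [Module R M'] [Module R M] [Module R M'']
    (E' : FilteredModule R X M') (E : FilteredModule R X M) (E'' : FilteredModule R X M'')
    (f : M' →ₗ[R] M) (g : M →ₗ[R] M''),
    Function.Injective f → Function.Exact f g → Function.Surjective g →
    FilteredModule.IsBicontrolled E' E f → FilteredModule.IsBicontrolled E E'' g →
    E.IsLeanModule → E''.IsInsular → E'.IsScattered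

/-- Distinct members of the collection `𝒜` of subsets are at distance greater than `r`. -/
def RDisjoint {X : Type*} [MetricSpace X] (r : ℝ) (𝒜 : Set (Set X)) : Prop :=
  ∀ A ∈ 𝒜, ∀ B ∈ 𝒜, A ≠ B → ∀ a ∈ A, ∀ b ∈ B, r < dist a b

/-- The family `𝒰` of subspaces is `r`-decomposable over the family `𝒱`: each member of `𝒰` is a
union of two sets, each of which is an `r`-disjoint union of members of `𝒱`. -/
def RDecomposable {X : Type*} [MetricSpace X] (r : ℝ) (𝒰 𝒱 : Set (Set X)) : Prop :=
  ∀ U ∈ 𝒰, ∃ 𝒜 ℬ : Set (Set X), 𝒜 ⊆ 𝒱 ∧ ℬ ⊆ 𝒱 ∧ RDisjoint r 𝒜 ∧ RDisjoint r ℬ ∧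
    U = ⋃₀ 𝒜 ∪ ⋃₀ ℬ

/-- The members of the family `𝒰` have diameters bounded by a common constant. -/
def UniformlyBoundedFamily {X : Type*} [MetricSpace X] (𝒰 : Set (Set X)) : Prop :=
  ∃ C : ℝ, ∀ U ∈ 𝒰, ∀ x ∈ U, ∀ y ∈ U, dist x y ≤ C

/-- Straight finite decomposition complexity: for each sequence `0 < R₀ ≤ R₁ ≤ ⋯` there are `n`
and families `𝒱₀ = {X}, 𝒱₁, …, 𝒱ₙ` with `𝒱ᵢ` being `Rᵢ`-decomposable over `𝒱ᵢ₊₁` for `i < n` and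
`𝒱ₙ` uniformly bounded. All the spaces involved are subspaces of `X`, so a family is a collection
of subsets of `X`; the values `𝒱 i` for `i > n` play no role. -/
def StraightFDC (X : Type*) [MetricSpace X] : Prop :=
  ∀ r : ℕ → ℝ, (∀ i, 0 < r i) → Monotone r →
    ∃ (n : ℕ) (𝒱 : ℕ → Set (Set X)), 𝒱 0 = {Set.univ} ∧
      (∀ i < n, RDecomposable (r i) (𝒱 i) (𝒱 (i + 1))) ∧ UniformlyBoundedFamily (𝒱 n)

/-!
Write `S[r]` for `Metric.cthickening r S`, and let `K = ker g`, with the filtration `K ∩ E(S)`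
induced from `E`. Since `f` is injective and bicontrolled with image `K`, the module `E'` is
scattered as soon as `K` is generated by the `K ∩ E(x[δ])` for some `δ`.

The heart of the matter is one decomposition step, `ker_inf_cthickening_le`: if
`U = ⋃₀ 𝒜 ∪ ⋃₀ ℬ` with `𝒜` and `ℬ` being `r`-disjoint, and `r` is large compared with `t`, then
`K ∩ E(U[t]) ⊆ ∑_{V ∈ 𝒜 ∪ ℬ} K ∩ E(V[t'])`, where `t' - t` depends only on the control constants.
It combines two consequences of insularity of `E''`:

* `ker_inf_sup_le` (a union of two sets). If `k = y + z` lies in `K`, with `y ∈ E(S)` and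
  `z ∈ E(T)`, then `g y = -g z` is supported near `S` and near `T`, hence on an intersection of
  enlargements. It lifts to some `c ∈ E` supported near both `S` and `T`, and
  `k = (y - c) + (z + c)` is a decomposition inside `K`.
* `ker_inf_iSup_le` (a disjoint union). If `k = ∑ k_V` lies in `K`, with `k_V ∈ E(V[s])` for `V` in
  an `r`-disjoint collection, then `g k_V` is supported near `V` and near the union of the other
  members. These enlargements do not meet, so `g k_V = 0`: every `k_V` already lies in `K`.

The enlargement added in each step, and the disjointness required of it, depend only on its
index `i` and the control constants. So the sequence `r i` can be prescribed before the
decomposition is known, which is what *straight* finite decomposition complexity demands. Iterating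
down to the uniformly bounded family `𝒱 n` gives generators of `K` supported on balls of a fixed
radius.
-/

namespace FilteredModule

variable {R X M M'' : Type*} [MetricSpace X] [Ring R] [AddCommGroup M] [AddCommGroup M'']
  [Module R M] [Module R M'']

/-- Leanness of `E`, applied to an enlargement of a subset of a union. The summand `1` makes up for
the infimum in the definition of `U[t]` not being attained. -/
theorem obj_cthickening_le_iSup {E : FilteredModule R X M} {D t : ℝ}
    (hD : ∀ S : Set X, E.obj S ≤ ⨆ x ∈ S, E.obj (Metric.closedBall x D)) (ht : 0 ≤ t)
    {U : Set X} {𝒜 : Set (Set X)} (hU : U ⊆ ⋃₀ 𝒜) :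
    E.obj (Metric.cthickening t U) ≤ ⨆ V ∈ 𝒜, E.obj (Metric.cthickening (t + 1 + D) V) := by
  refine (hD _).trans (iSup₂_le fun x hx => ?_)
  have hx' := Metric.cthickening_subset_thickening' (by linarith : 0 < t + 1) (by linarith) U hx
  obtain ⟨u, huU, hxu⟩ := Metric.mem_thickening_iff.1 hx'
  obtain ⟨V, hV, huV⟩ := hU huU
  refine le_iSup₂_of_le V hV (E.mono fun y hy => ?_)
  refine Metric.mem_cthickening_of_dist_le y u _ V huV ?_
  have hyx := Metric.mem_closedBall.1 hy
  linarith [dist_triangle y x u]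

theorem ker_inf_sup_le {E : FilteredModule R X M} {E'' : FilteredModule R X M''}
    {g : M →ₗ[R] M''} {b d : ℝ} (hb : 0 ≤ b) (hd : 0 ≤ d)
    (hg : ∀ S : Set X, (E.obj S).map g ≤ E''.obj (Metric.cthickening b S) ∧
      LinearMap.range g ⊓ E''.obj S ≤ (E.obj (Metric.cthickening b S)).map g)
    (hE'' : ∀ S U : Set X,
      E''.obj S ⊓ E''.obj U ≤ E''.obj (Metric.cthickening d S ∩ Metric.cthickening d U))
    (S T : Set X) :
    LinearMap.ker g ⊓ (E.obj S ⊔ E.obj T) ≤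
      (LinearMap.ker g ⊓ E.obj (Metric.cthickening (b + (d + b)) S)) ⊔
        (LinearMap.ker g ⊓ E.obj (Metric.cthickening (b + (d + b)) T)) := by
  rintro k ⟨hk, hk'⟩
  obtain ⟨y, hy, z, hz, rfl⟩ := Submodule.mem_sup.1 hk'
  have hyz : g y = -g z := by
    have h0 : g (y + z) = 0 := hk
    rw [map_add] at h0
    exact eq_neg_of_add_eq_zero_left h0
  have hyS : g y ∈ E''.obj (Metric.cthickening b S) := (hg S).1 ⟨y, hy, rfl⟩
  have hyT : g y ∈ E''.obj (Metric.cthickening b T) := by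
    rw [hyz]
    exact Submodule.neg_mem _ ((hg T).1 ⟨z, hz, rfl⟩)
  obtain ⟨c, hc, hcy⟩ := (hg _).2 ⟨⟨y, rfl⟩, hE'' _ _ ⟨hyS, hyT⟩⟩
  have enlarge (A : Set X) : Metric.cthickening b (Metric.cthickening d (Metric.cthickening b A)) ⊆
      Metric.cthickening (b + (d + b)) A :=
    (Metric.cthickening_subset_of_subset b (Metric.cthickening_cthickening_subset hd hb A)).trans
      (Metric.cthickening_cthickening_subset hb (by positivity) A)
  have hcS := E.mono ((Metric.cthickening_subset_of_subset b Set.inter_subset_left).trans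
    (enlarge S)) hc
  have hcT := E.mono ((Metric.cthickening_subset_of_subset b Set.inter_subset_right).trans
    (enlarge T)) hc
  refine Submodule.mem_sup.2 ⟨y - c, ⟨?_, ?_⟩, z + c, ⟨?_, ?_⟩, by abel⟩
  · simp [hcy]
  · exact Submodule.sub_mem _ (E.mono (Metric.self_subset_cthickening S) hy) hcS
  · simp [hcy, hyz]
  · exact Submodule.add_mem _ (E.mono (Metric.self_subset_cthickening T) hz) hcT

theorem ker_inf_iSup_le {E : FilteredModule R X M} {E'' : FilteredModule R X M''}
    {g : M →ₗ[R] M''} {b d s r : ℝ} (hb : 0 ≤ b) (hd : 0 ≤ d) (hs : 0 ≤ s)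
    (hg : ∀ S : Set X, (E.obj S).map g ≤ E''.obj (Metric.cthickening b S))
    (hE'' : ∀ S U : Set X,
      E''.obj S ⊓ E''.obj U ≤ E''.obj (Metric.cthickening d S ∩ Metric.cthickening d U))
    {𝒜 : Set (Set X)} (h𝒜 : RDisjoint r 𝒜) (hr : 2 * (d + (b + s) + 1) ≤ r) :
    LinearMap.ker g ⊓ (⨆ V ∈ 𝒜, E.obj (Metric.cthickening s V)) ≤
      ⨆ V ∈ 𝒜, LinearMap.ker g ⊓ E.obj (Metric.cthickening s V) := by
  rintro k ⟨hk, hk'⟩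
  rw [iSup_subtype'] at hk' ⊢
  obtain ⟨φ, hφ, hφk⟩ := (Submodule.mem_iSup_iff_exists_finsupp _ _).1 hk'
  have supp (A : Set X) {m : M} (hm : m ∈ E.obj (Metric.cthickening s A)) :
      g m ∈ E''.obj (Metric.cthickening (b + s) A) :=
    E''.mono (Metric.cthickening_cthickening_subset hb hs A) (hg _ ⟨m, hm, rfl⟩)
  have hker (V : 𝒜) : g (φ V) = 0 := by
    classical
    by_cases hV : V ∈ φ.support
    swap
    · rw [Finsupp.notMem_support_iff.1 hV, map_zero]
    set W : Set X := ⋃₀ (𝒜 \ {V.1}) with hW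
    have hrest : ∑ V' ∈ φ.support.erase V, φ V' ∈ E.obj (Metric.cthickening s W) := by
      refine Submodule.sum_mem _ fun V' hV' => ?_
      refine E.mono (Metric.cthickening_subset_of_subset s ?_) (hφ V')
      exact Set.subset_sUnion_of_mem
        ⟨V'.2, fun h => Finset.ne_of_mem_erase hV' (Subtype.ext h)⟩
    have hsum : φ V + ∑ V' ∈ φ.support.erase V, φ V' = k := by
      rw [Finset.add_sum_erase _ _ hV]
      exact hφk
    have hneg : g (φ V) = -g (∑ V' ∈ φ.support.erase V, φ V') := by
      have h0 : g k = 0 := hk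
      rw [← hsum, map_add] at h0
      exact eq_neg_of_add_eq_zero_left h0
    have hVW : g (φ V) ∈ E''.obj (Metric.cthickening (b + s) W) := by
      rw [hneg]
      exact Submodule.neg_mem _ (supp W hrest)
    have hmem := hE'' _ _ ⟨supp V (hφ V), hVW⟩
    suffices hempty : Metric.cthickening d (Metric.cthickening (b + s) V.1) ∩
        Metric.cthickening d (Metric.cthickening (b + s) W) = ∅ by
      rwa [hempty, E''.obj_empty, Submodule.mem_bot] at hmem
    refine Set.eq_empty_of_forall_notMem fun x hx => ?_
    have near (A : Set X) (hA : x ∈ Metric.cthickening d (Metric.cthickening (b + s) A)) :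
        ∃ a ∈ A, dist x a < d + (b + s) + 1 :=
      Metric.mem_thickening_iff.1 <| Metric.cthickening_subset_thickening' (by positivity)
        (lt_add_one _) A (Metric.cthickening_cthickening_subset hd (by positivity) A hA)
    obtain ⟨v, hv, hxv⟩ := near V.1 hx.1
    obtain ⟨w, ⟨V', hV', hwV'⟩, hxw⟩ := near W hx.2
    have hlt := h𝒜 V.1 V.2 V' hV'.1 (fun h => hV'.2 h.symm) v hv w hwV'
    linarith [dist_triangle_left v w x]
  rw [← hφk]
  exact Submodule.sum_mem _ fun V _ => Submodule.mem_iSup_of_mem V ⟨hker V, hφ V⟩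

/-- One decomposition step: elements of `ker g` supported near a member of `𝒰` are sums of elements
of `ker g` supported near members of `𝒱`. -/
theorem ker_inf_cthickening_le {E : FilteredModule R X M} {E'' : FilteredModule R X M''}
    {g : M →ₗ[R] M''} {D b d t t' r : ℝ} (hD₀ : 0 ≤ D) (hb : 0 ≤ b) (hd : 0 ≤ d) (ht : 0 ≤ t)
    (hD : ∀ S : Set X, E.obj S ≤ ⨆ x ∈ S, E.obj (Metric.closedBall x D))
    (hg : ∀ S : Set X, (E.obj S).map g ≤ E''.obj (Metric.cthickening b S) ∧
      LinearMap.range g ⊓ E''.obj S ≤ (E.obj (Metric.cthickening b S)).map g)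
    (hE'' : ∀ S U : Set X,
      E''.obj S ⊓ E''.obj U ≤ E''.obj (Metric.cthickening d S ∩ Metric.cthickening d U))
    (ht' : t' = b + (d + b) + (t + 1 + D) + 1 + D) (hr : 2 * (d + (b + t') + 1) ≤ r)
    {𝒰 𝒱 : Set (Set X)} (h : RDecomposable r 𝒰 𝒱) {U : Set X} (hU : U ∈ 𝒰) :
    LinearMap.ker g ⊓ E.obj (Metric.cthickening t U) ≤
      ⨆ V ∈ 𝒱, LinearMap.ker g ⊓ E.obj (Metric.cthickening t' V) := by
  obtain ⟨𝒜, ℬ, h𝒜, hℬ, h𝒜r, hℬr, rfl⟩ := h U hU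
  have split : E.obj (Metric.cthickening t (⋃₀ 𝒜 ∪ ⋃₀ ℬ)) ≤
      E.obj (Metric.cthickening (t + 1 + D) (⋃₀ 𝒜)) ⊔
        E.obj (Metric.cthickening (t + 1 + D) (⋃₀ ℬ)) := by
    refine (obj_cthickening_le_iSup (𝒜 := {⋃₀ 𝒜, ⋃₀ ℬ}) hD ht (by simp)).trans ?_
    rw [iSup_pair]
  have piece {𝒞 : Set (Set X)} (h𝒞 : 𝒞 ⊆ 𝒱) (h𝒞r : RDisjoint r 𝒞) :
      LinearMap.ker g ⊓ E.obj (Metric.cthickening (b + (d + b))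
        (Metric.cthickening (t + 1 + D) (⋃₀ 𝒞))) ≤
      ⨆ V ∈ 𝒱, LinearMap.ker g ⊓ E.obj (Metric.cthickening t' V) := by
    have hle := (E.mono (Metric.cthickening_cthickening_subset (by positivity : 0 ≤ b + (d + b))
      (by positivity : 0 ≤ t + 1 + D) (⋃₀ 𝒞))).trans
        (obj_cthickening_le_iSup hD (by positivity) subset_rfl)
    rw [← ht'] at hle
    refine (inf_le_inf_left _ hle).trans ((ker_inf_iSup_le hb hd (by rw [ht']; positivity)
      (fun S => (hg S).1) hE'' h𝒞r hr).trans ?_)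
    exact biSup_mono h𝒞
  exact (inf_le_inf_left _ split).trans ((ker_inf_sup_le hb hd hg hE'' _ _).trans
    (sup_le (piece h𝒜 h𝒜r) (piece hℬ hℬr)))

end FilteredModule

open FilteredModule in
theorem mainTheorem5 (R : Type u) [Ring R] (X : Type v) [MetricSpace X]
    (hX : StraightFDC X) : CoarselyCoherent.{u, v, w} R X := by
  intro M' M M'' _ _ _ _ _ _ E' E E'' f g hf hfg _ hfb hgb hlean hins
  obtain ⟨a, ha, hfa⟩ := hfb
  obtain ⟨b, hb, hgb⟩ := hgb
  obtain ⟨D, hD₀, hD⟩ := hlean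
  obtain ⟨d, hd, hE''⟩ := hins
  -- `t i` is the enlargement reached after `i` decomposition steps.
  set c : ℝ := b + (d + b) + (1 + D) + 1 + D with hc
  have hc₀ : 0 ≤ c := by positivity
  let t : ℕ → ℝ := fun i => i * c
  have ht₀ (i : ℕ) : 0 ≤ t i := by positivity
  have ht_succ (i : ℕ) : t (i + 1) = b + (d + b) + (t i + 1 + D) + 1 + D := by
    simp only [t, hc]
    push_cast
    ring
  obtain ⟨n, 𝒱, h𝒱₀, hdec, C, hC⟩ := hX (fun i => 2 * (d + (b + t (i + 1)) + 1))
    (fun i => by have := ht₀ (i + 1); positivity)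
    (monotone_nat_of_le_succ fun i => by
      have : t (i + 1) ≤ t (i + 1 + 1) := by rw [ht_succ (i + 1)]; linarith
      linarith)
  have hker : ∀ i ≤ n,
      LinearMap.ker g ≤ ⨆ V ∈ 𝒱 i, LinearMap.ker g ⊓ E.obj (Metric.cthickening (t i) V) := by
    intro i
    induction i with
    | zero =>
      intro _
      rw [h𝒱₀, iSup_singleton, Set.univ_subset_iff.1 (Metric.self_subset_cthickening Set.univ),
        E.obj_univ, inf_top_eq]
    | succ i ih =>
      intro hi
      exact (ih (by omega)).trans (iSup₂_le fun U hU =>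
        ker_inf_cthickening_le hD₀ hb hd (ht₀ i) hD hgb hE'' (ht_succ i) le_rfl
          (hdec i (by omega)) hU)
  refine ⟨a + t n + 1 + |C|, by have := ht₀ n; positivity, fun m _ => ?_⟩
  have hle : LinearMap.ker g ≤
      (⨆ x : X, E'.obj (Metric.closedBall x (a + t n + 1 + |C|))).map f := by
    refine (hker n le_rfl).trans (iSup₂_le fun V hV => ?_)
    rw [LinearMap.exact_iff.1 hfg]
    refine ((hfa _).2).trans (Submodule.map_mono ?_)
    refine (E'.mono (Metric.cthickening_cthickening_subset ha (ht₀ n) V)).trans ?_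
    rcases V.eq_empty_or_nonempty with rfl | ⟨v, hv⟩
    · rw [Metric.cthickening_empty, E'.obj_empty]
      exact bot_le
    · refine le_iSup_of_le v (E'.mono fun y hy => ?_)
      obtain ⟨w, hw, hyw⟩ := Metric.mem_thickening_iff.1 <|
        Metric.cthickening_subset_thickening' (by have := ht₀ n; positivity)
          (lt_add_one (a + t n)) V hy
      refine Metric.mem_closedBall.2 ?_
      linarith [dist_triangle y w v, hC V hV w hw v hv, le_abs_self C]
  obtain ⟨m', hm', hfm⟩ := hle (show f m ∈ LinearMap.ker g from hfg.apply_apply_eq_zero m)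
  exact hf hfm ▸ hm'
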